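/- Let $\mathbb T=\mathbb R/\mathbb Z$ carry its quotient (arc-length) metric and Lebesgue measure $dx$ of total mass one. For a finite non-negative Borel measure $\mu$ on $\mathbb T$, its lower Hausdorff dimension is $$\dim_{\mathrm H}(\mu)=\inf\{\alpha:\ \text{there is a Borel set } F\subset\mathbb T \text{ with } \mu(F)\neq 0 \text{ and } \dim_{\mathrm H}F\le\alpha\}.$$ Let $q\ge 3$ be an integer and let $a\in[-1,1]$. Then the measures $\prod_{k=0}^{n-1}\bigl(1+a\cos(2\pi q^kx)\bigr)\,dx$ on $\mathbb T$ converge weakly, as $n\to\infty$, to a finite measure, the Riesz product $$\mu_{a,q}=\prod_{k=0}^{\infty}\bigl(1+a\cos(2\pi q^kx)\bigr),$$ and $$\dim_{\mathrm H}(\mu_{a,q})\ \ge\ 1-\frac{1-\log 2}{\log q}-\frac{4\pi}{q\log q}-\frac1{\log q}\Bigl(\frac1{\cos(\pi/q)}-1\Bigr).$$ -/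

import Mathlib

open MeasureTheory Filter Topology
open scoped ENNReal

/-- The lower Hausdorff dimension of a Borel measure `μ`: the infimum of all `α ∈ [0, ∞]` such that
some Borel set `F` has `μ F ≠ 0` and Hausdorff dimension at most `α`. -/
noncomputable def lowerHausdorffDim {X : Type*} [EMetricSpace X] [MeasurableSpace X] [BorelSpace X]
    (μ : Measure X) : ℝ≥0∞ :=
  sInf {α : ℝ≥0∞ | ∃ F : Set X, MeasurableSet F ∧ μ F ≠ 0 ∧ dimH F ≤ α}

/-- The function `x ↦ cos (2 π m x)` on the circle `ℝ / ℤ`. -/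
noncomputable def circleCos (m : ℕ) (x : UnitAddCircle) : ℝ := (fourier (m : ℤ) x).re

theorem circleCos_coe (m : ℕ) (x : ℝ) :
    circleCos m (x : UnitAddCircle) = Real.cos (2 * Real.pi * m * x) := by
  have h : (2 * (Real.pi : ℂ) * Complex.I * ((m : ℤ) : ℂ) * (x : ℂ) / ((1 : ℝ) : ℂ))
      = ((2 * Real.pi * m * x : ℝ) : ℂ) * Complex.I := by
    push_cast
    ring
  unfold circleCos
  rw [fourier_coe_apply, h, Complex.exp_ofReal_mul_I_re]

theorem continuous_circleCos (m : ℕ) : Continuous (circleCos m) :=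
  Complex.continuous_re.comp (fourier (m : ℤ)).continuous

/-- The partial product `∏_{k < n} (1 + a cos (2 π q ^ k x))` on the circle. -/
noncomputable def rieszDensity (a : ℝ) (q n : ℕ) (x : UnitAddCircle) : ℝ :=
  ∏ k ∈ Finset.range n, (1 + a * circleCos (q ^ k) x)

theorem continuous_rieszDensity (a : ℝ) (q n : ℕ) : Continuous (rieszDensity a q n) :=
  continuous_finsetProd _ fun k _ =>
    continuous_const.add (continuous_const.mul (continuous_circleCos (q ^ k)))

/-- The finite measure with density `rieszDensity a q n` (which is non-negative for `|a| ≤ 1`)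
with respect to Lebesgue measure `dx` on the circle (of total mass one). -/
noncomputable def rieszPartial (a : ℝ) (q n : ℕ) : FiniteMeasure UnitAddCircle :=
  ⟨(volume : Measure UnitAddCircle).withDensity fun x => ENNReal.ofReal (rieszDensity a q n x),
    isFiniteMeasure_withDensity_ofReal
      ((continuous_rieszDensity a q n).integrable_of_hasCompactSupport
        (HasCompactSupport.of_compactSpace _)).2⟩

/-- The Riesz product `∏_{k ≥ 0} (1 + a cos (2 π q ^ k x))`: the limit of the measures
`rieszPartial a q n` as `n → ∞` in the (Hausdorff) topology of weak convergence of finite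
measures. -/
noncomputable def rieszProduct (a : ℝ) (q : ℕ) : FiniteMeasure UnitAddCircle :=
  limUnder atTop (rieszPartial a q)

/-! Lebesgue measure is invariant under `x ↦ Q x` and under the rotations by `j / Q`, which do not
change `Q x`. Hence integrals of `v x * H (Q x)` are controlled by averages of `v` over the points
`x + j / Q`; this transfer-operator bound (`lintegral_mul_comp_nsmul_le` and its iterate) drives all
the measure estimates.

Weak convergence: peeling off the first factor expresses the Fourier integral at `m` through those
at `m` and `m ± 1` of a function of `q x`. Only multiples of `q` survive, and dividing by `q` lowers
the frequency, so every Fourier integral converges; compactness of the set of measures of mass at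
most one does the rest.

Dimension: let `S_n` be the sum of the logarithms of the first `n` factors, each shifted by `ε` to
avoid zeros. Bounded distortion gives `μ (ball x (q⁻ⁿ / 2)) ≤ C exp (S_n x) q⁻ⁿ`
(`rieszProduct_ball_le`). Exponential moments of `S_n` under `μ` are controlled by fibre averages
which, to first order in the exponent, are Riemann sums of `t log t` with `t = 1 + a cos`. The
integral is at most `1 - log 2` by convexity, and the Riemann sum error is at most `4 π / q` by a
Lipschitz bound. Chebyshev and Borel–Cantelli give `S_n ≤ n λ` eventually, almost everywhere, for
each `λ > 1 - log 2 + 4 π / q`, and the mass distribution principle turns this into dimension at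
least `1 - λ / log q`. The correction term with `cos (π / q)` is non-negative and is simply given
away. -/

/-! ### Fibre averages under multiplication by `Q` -/

theorem measurePreserving_nsmul_circle {Q : ℕ} (hQ : 0 < Q) :
    MeasurePreserving (fun x : UnitAddCircle => Q • x) volume volume := by
  rcases Nat.lt_or_ge 1 Q with h | h
  · exact (AddCircle.ergodic_nsmul h).toMeasurePreserving
  · obtain rfl : Q = 1 := by omega
    simp only [one_smul]
    exact MeasurePreserving.id volume

/-- The rational rotation `j / Q` as a point of the circle. -/
noncomputable def circleRat (Q j : ℕ) : UnitAddCircle := (((j : ℝ) / Q : ℝ) : UnitAddCircle)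

theorem nsmul_circleRat {Q : ℕ} (hQ : 0 < Q) (j : ℕ) : Q • circleRat Q j = 0 := by
  have hQ' : (Q : ℝ) ≠ 0 := by positivity
  have h : (Q • ((j : ℝ) / Q)) = (j : ℕ) • (1 : ℝ) := by
    simp only [nsmul_eq_mul]
    field_simp
  rw [circleRat, ← AddCircle.coe_nsmul, h, AddCircle.coe_nsmul, AddCircle.coe_period, smul_zero]

/-- Rotating by `j / Q` fixes the factor `H (Q • x)`, so `v` may be replaced by its average over the
fibre. -/
theorem lintegral_mul_comp_nsmul_le {Q : ℕ} (hQ : 0 < Q) {v H : UnitAddCircle → ℝ≥0∞}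
    (hv : Measurable v) (hH : Measurable H) {c : ℝ≥0∞}
    (h : ∀ x, ∑ j ∈ Finset.range Q, v (x + circleRat Q j) ≤ Q * c) :
    ∫⁻ x, v x * H (Q • x) ≤ c * ∫⁻ x, H x := by
  have hQ0 : (Q : ℝ≥0∞) ≠ 0 := by exact_mod_cast hQ.ne'
  have hmp := measurePreserving_nsmul_circle hQ
  have hHQ : Measurable fun x : UnitAddCircle => H (Q • x) := hH.comp hmp.measurable
  rw [← ENNReal.mul_le_mul_iff_right hQ0 (ENNReal.natCast_ne_top Q)]
  calc (Q : ℝ≥0∞) * ∫⁻ x, v x * H (Q • x)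
      = ∑ j ∈ Finset.range Q, ∫⁻ x, v x * H (Q • x) := by simp
    _ = ∑ j ∈ Finset.range Q, ∫⁻ x, v (x + circleRat Q j) * H (Q • x) := by
        refine Finset.sum_congr rfl fun j _ => ?_
        rw [← lintegral_add_right_eq_self _ (circleRat Q j)]
        simp [nsmul_circleRat hQ]
    _ = ∫⁻ x, (∑ j ∈ Finset.range Q, v (x + circleRat Q j)) * H (Q • x) := by
        simp_rw [Finset.sum_mul]
        rw [lintegral_finsetSum]
        intro j _
        exact (hv.comp (measurable_add_const _)).mul hHQ
    _ ≤ ∫⁻ x, (Q * c) * H (Q • x) := by gcongr with x; exact h x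
    _ = Q * (c * ∫⁻ x, H x) := by
        rw [lintegral_const_mul _ hHQ, hmp.lintegral_comp hH, mul_assoc]

/-- Once the factor `k = 0` is removed, everything else is a function of `Q • x`, so the one-step
bound iterates. -/
theorem lintegral_prod_mul_comp_nsmul_le {Q : ℕ} (hQ : 0 < Q) {v H : UnitAddCircle → ℝ≥0∞}
    (hv : Measurable v) (hH : Measurable H) {c : ℝ≥0∞}
    (h : ∀ x, ∑ j ∈ Finset.range Q, v (x + circleRat Q j) ≤ Q * c) (n : ℕ) :
    ∫⁻ x, (∏ k ∈ Finset.range n, v (Q ^ k • x)) * H (Q ^ n • x) ≤ c ^ n * ∫⁻ x, H x := by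
  have hm : ∀ k : ℕ, Measurable fun x : UnitAddCircle => Q ^ k • x := fun k =>
    (measurePreserving_nsmul_circle (pow_pos hQ k)).measurable
  induction n with
  | zero => simp
  | succ n ih =>
    calc ∫⁻ x, (∏ k ∈ Finset.range (n + 1), v (Q ^ k • x)) * H (Q ^ (n + 1) • x)
        = ∫⁻ x, v x * (fun y => (∏ k ∈ Finset.range n, v (Q ^ k • y)) * H (Q ^ n • y)) (Q • x) := by
          refine lintegral_congr fun x => ?_
          simp only [Finset.prod_range_succ', pow_succ, mul_smul, pow_zero, one_smul]
          ring
      _ ≤ c * ∫⁻ y, (∏ k ∈ Finset.range n, v (Q ^ k • y)) * H (Q ^ n • y) :=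
          lintegral_mul_comp_nsmul_le hQ hv
            ((Finset.measurable_fun_prod _ fun k _ => hv.comp (hm k)).mul (hH.comp (hm n))) h
      _ ≤ c * (c ^ n * ∫⁻ x, H x) := by gcongr
      _ = c ^ (n + 1) * ∫⁻ x, H x := by ring

/-! ### The factors of the product and their cocycle identity -/

theorem circleCos_mul (m n : ℕ) (x : UnitAddCircle) :
    circleCos (m * n) x = circleCos m (n • x) := by
  simp only [circleCos, fourier_apply]
  rw [← natCast_zsmul x n, smul_smul]
  push_cast
  rfl

theorem abs_circleCos_le (m : ℕ) (x : UnitAddCircle) : |circleCos m x| ≤ 1 := by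
  obtain ⟨x, rfl⟩ := QuotientAddGroup.mk_surjective x
  exact (congrArg _ (circleCos_coe m x)).trans_le (Real.abs_cos_le_one _)

theorem one_add_mul_circleCos_nonneg {a : ℝ} (ha : a ∈ Set.Icc (-1 : ℝ) 1) (m : ℕ)
    (x : UnitAddCircle) : 0 ≤ 1 + a * circleCos m x := by
  have h : |a * circleCos m x| ≤ 1 := by
    rw [abs_mul]
    exact mul_le_one₀ (abs_le.2 ha) (abs_nonneg _) (abs_circleCos_le m x)
  linarith [(abs_le.1 h).1]

theorem rieszDensity_nonneg {a : ℝ} (ha : a ∈ Set.Icc (-1 : ℝ) 1) (q n : ℕ) (x : UnitAddCircle) :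
    0 ≤ rieszDensity a q n x :=
  Finset.prod_nonneg fun k _ => one_add_mul_circleCos_nonneg ha (q ^ k) x

theorem rieszDensity_add (a : ℝ) (q n m : ℕ) (x : UnitAddCircle) :
    rieszDensity a q (n + m) x = rieszDensity a q n x * rieszDensity a q m (q ^ n • x) := by
  simp only [rieszDensity, Finset.prod_range_add]
  congr 1
  refine Finset.prod_congr rfl fun k _ => ?_
  rw [← circleCos_mul, pow_add, mul_comm (q ^ n)]

/-! ### Convergence of the Fourier integrals -/

/-- Fourier modes not divisible by `Q` integrate to zero against functions of `Q x`. -/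
theorem integral_fourier_mul_comp_nsmul {Q : ℕ} (hQ : 0 < Q) (k : ℤ) (H : UnitAddCircle → ℂ)
    (hk : ¬ (Q : ℤ) ∣ k) : ∫ x : UnitAddCircle, fourier k x * H (Q • x) = 0 := by
  -- Translation by `1 / Q` multiplies the integral by `exp (2 π i k / Q)`, which differs from `1`.
  have h := integral_add_right_eq_self (μ := (volume : Measure UnitAddCircle))
    (fun x : UnitAddCircle => fourier k x * H (Q • x)) (circleRat Q 1)
  have e : ∀ x : UnitAddCircle, fourier k (x + circleRat Q 1) * H (Q • (x + circleRat Q 1))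
      = fourier k (circleRat Q 1) * (fourier k x * H (Q • x)) := by
    intro x
    have : fourier k (x + circleRat Q 1) = fourier k x * fourier k (circleRat Q 1) := by
      simp only [fourier_apply, smul_add, AddCircle.toCircle_add, Circle.coe_mul]
    rw [this, nsmul_add, nsmul_circleRat hQ, add_zero]
    ring
  simp only [e] at h
  rw [integral_const_mul] at h
  have hne : fourier k (circleRat Q 1) ≠ (1 : ℂ) := by
    rw [circleRat, fourier_coe_apply]
    intro h1
    obtain ⟨n, hn⟩ := Complex.exp_eq_one_iff.1 h1
    have hQ' : (Q : ℂ) ≠ 0 := by exact_mod_cast hQ.ne'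
    have h2 : (k : ℂ) = Q * n := by
      have hpi : (2 * (Real.pi : ℂ) * Complex.I) ≠ 0 := Complex.two_pi_I_ne_zero
      push_cast at hn
      field_simp at hn
      exact hn
    exact hk ⟨n, by exact_mod_cast h2⟩
  by_contra h0
  exact hne (mul_right_cancel₀ h0 (by rw [h, one_mul]))

theorem integral_fourier_mul_comp_nsmul_mul {Q : ℕ} (hQ : 0 < Q) (k : ℤ)
    {H : UnitAddCircle → ℂ} (hH : Continuous H) :
    ∫ x : UnitAddCircle, fourier (Q * k) x * H (Q • x) = ∫ x, fourier k x * H x := by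
  have hmp := measurePreserving_nsmul_circle hQ
  have e : ∀ x : UnitAddCircle, fourier ((Q : ℤ) * k) x = fourier k (Q • x) := by
    intro x
    rw [fourier_apply, fourier_apply, ← natCast_zsmul x Q, smul_smul, mul_comm]
  simp only [e]
  have h := integral_map (μ := (volume : Measure UnitAddCircle)) hmp.aemeasurable
    (f := fun x => fourier k x * H x) ((fourier k).continuous.mul hH).aestronglyMeasurable
  rw [hmp.map_eq] at h
  exact h.symm

/-- Fourier integrals of the partial Riesz products. -/
noncomputable def rieszFourier (a : ℝ) (q : ℕ) (m : ℤ) (n : ℕ) : ℂ :=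
  ∫ x : UnitAddCircle, fourier m x * (rieszDensity a q n x : ℂ)

theorem continuous_ofReal_rieszDensity (a : ℝ) (q n : ℕ) :
    Continuous fun x => (rieszDensity a q n x : ℂ) :=
  Complex.continuous_ofReal.comp (continuous_rieszDensity a q n)

theorem rieszFourier_succ (a : ℝ) (q : ℕ) (m : ℤ) (n : ℕ) :
    rieszFourier a q m (n + 1) =
      (∫ x : UnitAddCircle, fourier m x * (rieszDensity a q n (q • x) : ℂ))
      + a / 2 * (∫ x : UnitAddCircle, fourier (m + 1) x * (rieszDensity a q n (q • x) : ℂ))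
      + a / 2 * (∫ x : UnitAddCircle, fourier (m - 1) x * (rieszDensity a q n (q • x) : ℂ)) := by
  have hc : Continuous fun x : UnitAddCircle => (rieszDensity a q n (q • x) : ℂ) :=
    (continuous_ofReal_rieszDensity a q n).comp (continuous_const_smul q)
  have hi : ∀ k : ℤ, Integrable fun x : UnitAddCircle =>
      fourier k x * (rieszDensity a q n (q • x) : ℂ) := fun k =>
    ((fourier k).continuous.mul hc).integrable_of_hasCompactSupport
      (HasCompactSupport.of_compactSpace _)
  have hi' : Integrable fun x : UnitAddCircle => fourier m x * (rieszDensity a q n (q • x) : ℂ)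
      + a / 2 * (fourier (m + 1) x * (rieszDensity a q n (q • x) : ℂ)) :=
    (hi m).add ((hi _).const_mul _)
  rw [← integral_const_mul, ← integral_const_mul, ← integral_add (hi m) ((hi _).const_mul _),
    ← integral_add hi' ((hi _).const_mul _), rieszFourier]
  congr 1
  ext x
  have h1 : rieszDensity a q (n + 1) x = (1 + a * circleCos 1 x) * rieszDensity a q n (q • x) := by
    rw [add_comm, rieszDensity_add]
    simp [rieszDensity]
  have h2 : (circleCos 1 x : ℂ) = (fourier 1 x + fourier (-1) x) / 2 := by
    rw [circleCos, fourier_neg, Complex.re_eq_add_conj]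
    simp
  rw [h1]
  push_cast
  rw [h2, fourier_add, sub_eq_add_neg, fourier_add]
  ring

theorem rieszFourier_zero (a : ℝ) {q : ℕ} (hq : 3 ≤ q) (n : ℕ) : rieszFourier a q 0 n = 1 := by
  induction n with
  | zero => simp [rieszFourier, rieszDensity, Measure.real]
  | succ n ih =>
    have h1 : ¬ (q : ℤ) ∣ 0 + 1 := fun h => by
      have := Int.le_of_dvd (by norm_num) h
      omega
    have h2 : ¬ (q : ℤ) ∣ 0 - 1 := fun h => by
      have := Int.le_of_dvd (by norm_num) ((dvd_neg).2 h)
      omega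
    have h3 := integral_fourier_mul_comp_nsmul_mul (by omega : 0 < q) 0
      (continuous_ofReal_rieszDensity a q n)
    rw [rieszFourier_succ a q, integral_fourier_mul_comp_nsmul (by omega) _
      (fun y => (rieszDensity a q n y : ℂ)) h1, integral_fourier_mul_comp_nsmul (by omega) _
      (fun y => (rieszDensity a q n y : ℂ)) h2]
    rw [mul_zero] at h3
    rw [h3, ← rieszFourier, ih]
    simp

/-- Strong induction on `|m|`. A surviving frequency `k = q k'` has `|k| ≤ |m| + 1`, and `q ≥ 3`
forces `|k'| < |m|` when `m ≠ 0`; for `q = 2` the step from `m = 1` to `k = 2` would return to `1`.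
-/
theorem exists_tendsto_rieszFourier (a : ℝ) {q : ℕ} (hq : 3 ≤ q) (m : ℤ) :
    ∃ l, Tendsto (rieszFourier a q m) atTop (𝓝 l) := by
  induction hd : m.natAbs using Nat.strong_induction_on generalizing m with
  | _ d ih =>
    subst hd
    rcases eq_or_ne m 0 with rfl | hm
    · exact ⟨1, by simp [funext (rieszFourier_zero a hq)]⟩
    have key : ∀ k : ℤ, k.natAbs ≤ m.natAbs + 1 → ∃ l, Tendsto (fun n =>
        ∫ x : UnitAddCircle, fourier k x * (rieszDensity a q n (q • x) : ℂ)) atTop (𝓝 l) := by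
      intro k hk
      by_cases hdvd : (q : ℤ) ∣ k
      · obtain ⟨k', rfl⟩ := hdvd
        have hlt : k'.natAbs < m.natAbs := by
          rw [Int.natAbs_mul, Int.natAbs_natCast] at hk
          have : 3 * k'.natAbs ≤ q * k'.natAbs := Nat.mul_le_mul_right _ hq
          omega
        obtain ⟨l, hl⟩ := ih _ hlt k' rfl
        refine ⟨l, hl.congr fun n => ?_⟩
        exact (integral_fourier_mul_comp_nsmul_mul (by omega : 0 < q) k'
          (continuous_ofReal_rieszDensity a q n)).symm
      · refine ⟨0, tendsto_const_nhds.congr fun n => ?_⟩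
        exact (integral_fourier_mul_comp_nsmul (by omega) k
          (fun y => (rieszDensity a q n y : ℂ)) hdvd).symm
    obtain ⟨l0, h0⟩ := key m (by omega)
    obtain ⟨l1, h1⟩ := key (m + 1) (by omega)
    obtain ⟨l2, h2⟩ := key (m - 1) (by omega)
    refine ⟨l0 + a / 2 * l1 + a / 2 * l2, (tendsto_add_atTop_iff_nat 1).1 ?_⟩
    refine Tendsto.congr (fun n => (rieszFourier_succ a q m n).symm) ?_
    exact (h0.add (h1.const_mul _)).add (h2.const_mul _)

/-! ### Weak convergence of the partial products -/

theorem rieszPartial_apply (a : ℝ) (q n : ℕ) {s : Set UnitAddCircle} (hs : MeasurableSet s) :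
    (rieszPartial a q n : Measure UnitAddCircle) s
      = ∫⁻ x in s, ENNReal.ofReal (rieszDensity a q n x) :=
  withDensity_apply _ hs

theorem measurable_ofReal_rieszDensity (a : ℝ) (q n : ℕ) :
    Measurable fun x => ENNReal.ofReal (rieszDensity a q n x) :=
  (continuous_rieszDensity a q n).measurable.ennreal_ofReal

theorem integrable_rieszDensity (a : ℝ) (q n : ℕ) : Integrable (rieszDensity a q n) :=
  (continuous_rieszDensity a q n).integrable_of_hasCompactSupport
    (HasCompactSupport.of_compactSpace _)

theorem lintegral_rieszDensity {a : ℝ} (ha : a ∈ Set.Icc (-1 : ℝ) 1) {q : ℕ} (hq : 3 ≤ q) (n : ℕ) :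
    ∫⁻ x, ENNReal.ofReal (rieszDensity a q n x) = 1 := by
  rw [← ofReal_integral_eq_lintegral_ofReal (integrable_rieszDensity a q n)
    (ae_of_all _ (rieszDensity_nonneg ha q n))]
  have h := rieszFourier_zero a hq n
  simp only [rieszFourier, fourier_zero, one_mul] at h
  rw [integral_complex_ofReal] at h
  rw [show ∫ x, rieszDensity a q n x = 1 by exact_mod_cast h, ENNReal.ofReal_one]

theorem integral_fourier_rieszPartial {a : ℝ} (ha : a ∈ Set.Icc (-1 : ℝ) 1) (q n : ℕ) (m : ℤ) :
    ∫ x, fourier m x ∂(rieszPartial a q n : Measure UnitAddCircle) = rieszFourier a q m n := by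
  change ∫ x, fourier m x ∂((volume : Measure UnitAddCircle).withDensity
    fun x => ENNReal.ofReal (rieszDensity a q n x)) = _
  rw [integral_withDensity_eq_integral_toReal_smul (measurable_ofReal_rieszDensity a q n)
    (ae_of_all _ fun _ => ENNReal.ofReal_lt_top), rieszFourier]
  congr 1
  ext x
  rw [ENNReal.toReal_ofReal (rieszDensity_nonneg ha q n x), Complex.real_smul, mul_comm]

theorem isProbabilityMeasure_rieszPartial {a : ℝ} (ha : a ∈ Set.Icc (-1 : ℝ) 1) {q : ℕ}
    (hq : 3 ≤ q) (n : ℕ) : IsProbabilityMeasure (rieszPartial a q n : Measure UnitAddCircle) :=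
  ⟨by rw [rieszPartial_apply a q n MeasurableSet.univ, setLIntegral_univ,
    lintegral_rieszDensity ha hq]⟩

/-- Two finite measures on the circle with the same Fourier integrals coincide. -/
theorem finiteMeasure_ext_of_fourier {μ ν : FiniteMeasure UnitAddCircle}
    (h : ∀ m : ℤ, ∫ x, fourier m x ∂(μ : Measure UnitAddCircle)
      = ∫ x, fourier m x ∂(ν : Measure UnitAddCircle)) : μ = ν := by
  let S : StarSubalgebra ℂ (BoundedContinuousFunction UnitAddCircle ℂ) :=
    (fourierSubalgebra (T := 1)).comap (BoundedContinuousFunction.toContinuousMapStarₐ ℂ)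
  have hcomap : ∀ f : C(UnitAddCircle, ℂ), f ∈ fourierSubalgebra (T := 1) →
      ∫ x, f x ∂(μ : Measure UnitAddCircle) = ∫ x, f x ∂(ν : Measure UnitAddCircle) := by
    intro f hf
    rw [← SetLike.mem_coe] at hf
    have hf' : f ∈ Submodule.span ℂ (Set.range (@fourier 1)) := by
      rw [← fourierSubalgebra_coe]
      exact hf
    clear hf
    have hi : ∀ (g : C(UnitAddCircle, ℂ)) (ρ : FiniteMeasure UnitAddCircle),
        Integrable g (ρ : Measure UnitAddCircle) := fun g ρ =>
      g.continuous.integrable_of_hasCompactSupport (HasCompactSupport.of_compactSpace _)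
    induction hf' using Submodule.span_induction with
    | mem g hg => obtain ⟨m, rfl⟩ := hg; exact h m
    | zero => simp
    | add g g' _ _ h1 h2 =>
      simp only [ContinuousMap.add_apply]
      rw [integral_add (hi g μ) (hi g' μ), integral_add (hi g ν) (hi g' ν), h1, h2]
    | smul c g _ h1 =>
      simp only [ContinuousMap.smul_apply]
      rw [integral_smul, integral_smul, h1]
  refine FiniteMeasure.toMeasure_injective (ext_of_forall_mem_subalgebra_integral_eq_of_polish
    (P := (μ : Measure UnitAddCircle)) (P' := (ν : Measure UnitAddCircle)) (A := S) ?_ ?_)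
  · intro x y hxy
    refine ⟨fourier 1, ⟨fourier 1, ⟨BoundedContinuousFunction.mkOfCompact (fourier 1),
      Algebra.subset_adjoin ⟨1, rfl⟩, rfl⟩, rfl⟩, fun hf => hxy ?_⟩
    rw [fourier_one, fourier_one] at hf
    exact AddCircle.injective_toCircle one_ne_zero (Subtype.ext hf)
  · intro g hg
    exact hcomap (g : C(UnitAddCircle, ℂ)) hg

/-- A sequence of probability measures on the circle with convergent Fourier integrals
converges weakly. -/
theorem exists_tendsto_of_tendsto_fourier {u : ℕ → FiniteMeasure UnitAddCircle}
    (hu : ∀ n, IsProbabilityMeasure (u n : Measure UnitAddCircle))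
    (h : ∀ m : ℤ, ∃ l, Tendsto (fun n => ∫ x, fourier m x ∂(u n : Measure UnitAddCircle))
      atTop (𝓝 l)) : ∃ μ, Tendsto u atTop (𝓝 μ) := by
  have hK := isCompact_setOfPred_finiteMeasure_le_of_compactSpace UnitAddCircle 1
  have hmem : ∀ n, u n ∈ {μ : FiniteMeasure UnitAddCircle | μ.mass ≤ 1} := fun n => by
    have h1 : (u n).mass = 1 := by
      rw [← ENNReal.coe_inj, FiniteMeasure.ennreal_mass]
      exact (hu n).measure_univ
    exact h1.le
  have hlim : ∀ (μ : FiniteMeasure UnitAddCircle) (F : Ultrafilter ℕ), (F : Filter ℕ) ≤ atTop →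
      Tendsto u F (𝓝 μ) → ∀ m l, Tendsto (fun n => ∫ x, fourier m x ∂(u n : Measure UnitAddCircle))
      atTop (𝓝 l) → ∫ x, fourier m x ∂(μ : Measure UnitAddCircle) = l := by
    intro μ F hF hμ m l hl
    refine tendsto_nhds_unique ?_ (hl.mono_left hF)
    exact (FiniteMeasure.tendsto_iff_forall_integral_rclike_tendsto ℂ).1 hμ
      (BoundedContinuousFunction.mkOfCompact (fourier m))
  obtain ⟨μ, -, hμ⟩ := hK.exists_mapClusterPt_of_frequently (l := atTop) (f := u)
    (Frequently.of_forall hmem)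
  -- All cluster points share the limiting Fourier integrals, hence coincide.
  refine ⟨μ, hK.tendsto_nhds_of_unique_mapClusterPt (Eventually.of_forall hmem) ?_⟩
  intro ν _ hν
  obtain ⟨F, hF, hFμ⟩ := mapClusterPt_iff_ultrafilter.1 hμ
  obtain ⟨G, hG, hGν⟩ := mapClusterPt_iff_ultrafilter.1 hν
  refine finiteMeasure_ext_of_fourier fun m => ?_
  obtain ⟨l, hl⟩ := h m
  rw [hlim μ F hF hFμ m l hl, hlim ν G hG hGν m l hl]

theorem tendsto_rieszPartial {a : ℝ} (ha : a ∈ Set.Icc (-1 : ℝ) 1) {q : ℕ} (hq : 3 ≤ q) :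
    Tendsto (rieszPartial a q) atTop (𝓝 (rieszProduct a q)) := by
  refine tendsto_nhds_limUnder (exists_tendsto_of_tendsto_fourier
    (isProbabilityMeasure_rieszPartial ha hq) fun m => ?_)
  simp only [integral_fourier_rieszPartial ha]
  exact exists_tendsto_rieszFourier a hq m

/-- The portmanteau inequality on open sets; only the tail of the sequence matters, so estimates are
needed just for indices `n + m`. -/
theorem rieszProduct_open_le {a : ℝ} (ha : a ∈ Set.Icc (-1 : ℝ) 1) {q : ℕ} (hq : 3 ≤ q)
    {U : Set UnitAddCircle} (hU : IsOpen U) {n : ℕ} {c : ℝ≥0∞}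
    (h : ∀ m, (rieszPartial a q (n + m) : Measure UnitAddCircle) U ≤ c) :
    (rieszProduct a q : Measure UnitAddCircle) U ≤ c := by
  have hlim := tendsto_rieszPartial ha hq
  have hp := isProbabilityMeasure_rieszPartial ha hq
  have hone : IsProbabilityMeasure (rieszProduct a q : Measure UnitAddCircle) := by
    have h1 := ((FiniteMeasure.continuous_mass.tendsto _).comp hlim)
    have h2 : (FiniteMeasure.mass ∘ rieszPartial a q) = fun _ => 1 := by
      ext n
      simp only [Function.comp]
      rw [show (rieszPartial a q n).mass = 1 by
        rw [← ENNReal.coe_inj, FiniteMeasure.ennreal_mass]; exact (hp n).measure_univ]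
    rw [h2] at h1
    have h3 := tendsto_nhds_unique h1 tendsto_const_nhds
    exact ⟨by rw [← FiniteMeasure.ennreal_mass, h3, ENNReal.coe_one]⟩
  let P : ℕ → ProbabilityMeasure UnitAddCircle := fun n => ⟨rieszPartial a q n, hp n⟩
  have hP : Tendsto P atTop (𝓝 ⟨rieszProduct a q, hone⟩) :=
    (ProbabilityMeasure.tendsto_nhds_iff_toFiniteMeasure_tendsto_nhds _).2 hlim
  refine (ProbabilityMeasure.le_liminf_measure_open_of_tendsto hP hU).trans ?_
  refine liminf_le_of_frequently_le' (Eventually.frequently ?_)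
  filter_upwards [eventually_ge_atTop n] with N hN
  obtain ⟨m, rfl⟩ := Nat.exists_eq_add_of_le hN
  exact h m

/-! ### The mass distribution principle -/

/-- Mass distribution principle: if the balls of radius `1 / (2 b ^ n)` centred in a set `G` of
positive measure have measure at most `C b ^ (-t n)`, then `G` has dimension at least `t`. -/
theorem le_dimH_of_measure_ball_le {X : Type*} [MetricSpace X] [MeasurableSpace X] [BorelSpace X]
    {μ : Measure X} {G : Set X} (hG : MeasurableSet G) (hμG : μ G ≠ 0) {b C : ℝ} {t : NNReal}
    (hb : 1 < b) (hC : 0 < C) (ht : 0 < t) (n₀ : ℕ)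
    (h : ∀ x ∈ G, ∀ n ≥ n₀,
      μ (Metric.ball x (1 / (2 * b ^ n))) ≤ ENNReal.ofReal (C * (b ^ (-(t : ℝ))) ^ n)) :
    (t : ℝ≥0∞) ≤ dimH G := by
  by_contra hlt
  have h0 : μH[(t : ℝ)] G = 0 := hausdorffMeasure_of_dimH_lt (not_le.1 hlt)
  have hb0 : 0 < b := by linarith
  have ht' : (0 : ℝ) < t := by exact_mod_cast ht
  -- A set of diameter `d` is compared with a ball of radius `1 / (2 b ^ k)` where `b⁻ᵏ < 2 b² d`;
  -- this is the origin of `2 b ^ 2`.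
  set D : ℝ := C * (2 * b ^ 2) ^ (t : ℝ) with hD
  have hDpos : 0 < D := by positivity
  have hD0 : ENNReal.ofReal D ≠ 0 := by simpa using hDpos
  have hDt : ENNReal.ofReal D ≠ ⊤ := ENNReal.ofReal_ne_top
  have hβ1 : b ^ (-(t : ℝ)) < 1 := Real.rpow_lt_one_of_one_lt_of_neg hb (by linarith)
  have key : (ENNReal.ofReal D)⁻¹ • μ.restrict G ≤ μH[(t : ℝ)] := by
    refine Measure.le_hausdorffMeasure _ _ (ENNReal.ofReal (1 / (4 * b ^ (n₀ + 1))))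
      (by simp only [ENNReal.ofReal_pos]; positivity) fun s hs => ?_
    rw [Measure.smul_apply, smul_eq_mul, Measure.restrict_apply' hG,
      ENNReal.inv_mul_le_iff hD0 hDt]
    rcases (s ∩ G).eq_empty_or_nonempty with he | ⟨x, hxs, hxG⟩
    · simp [he]
    have hfin : Metric.ediam s ≠ ⊤ := ne_top_of_le_ne_top ENNReal.ofReal_ne_top hs
    set d : ℝ := (Metric.ediam s).toReal with hd
    have hde : Metric.ediam s = ENNReal.ofReal d := (ENNReal.ofReal_toReal hfin).symm
    have hd0 : 0 ≤ d := ENNReal.toReal_nonneg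
    have hsub : ∀ n, d < 1 / (2 * b ^ n) → s ∩ G ⊆ Metric.ball x (1 / (2 * b ^ n)) := by
      intro n hn y hy
      have : edist y x ≤ ENNReal.ofReal d := hde ▸ Metric.edist_le_ediam_of_mem hy.1 hxs
      rw [edist_dist] at this
      exact ((ENNReal.ofReal_le_ofReal_iff hd0).1 this).trans_lt hn
    rw [hde]
    -- At diameter zero the target is `0 ^ t = 0`, so the ball bound is used at all scales `n → ∞`.
    rcases hd0.eq_or_lt with hz | hpos
    · have hle : ∀ n ≥ n₀, μ (s ∩ G) ≤ ENNReal.ofReal (C * (b ^ (-(t : ℝ))) ^ n) := fun n hn =>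
        (measure_mono (hsub n (by rw [← hz]; positivity))).trans (h x hxG n hn)
      have hl : Tendsto (fun n : ℕ => ENNReal.ofReal (C * (b ^ (-(t : ℝ))) ^ n)) atTop (𝓝 0) := by
        have := (tendsto_pow_atTop_nhds_zero_of_lt_one (by positivity) hβ1).const_mul C
        rw [mul_zero] at this
        simpa using ENNReal.tendsto_ofReal this
      exact (ge_of_tendsto hl (eventually_atTop.2 ⟨n₀, hle⟩)).trans zero_le
    · have hd1 : d ≤ 1 / (4 * b ^ (n₀ + 1)) := by
        rw [hde] at hs
        exact (ENNReal.ofReal_le_ofReal_iff (by positivity)).1 hs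
      have hbn : 1 ≤ b ^ (n₀ + 1) := one_le_pow₀ hb.le
      have hd2 : 2 * d < 1 / b ^ (n₀ + 1) := by
        rw [lt_div_iff₀ (by positivity)]
        rw [le_div_iff₀ (by positivity)] at hd1
        nlinarith
      have hd3 : 2 * d ≤ 1 := hd2.le.trans (by rw [div_le_one (by positivity)]; exact hbn)
      obtain ⟨n, hn1, hn2⟩ := exists_nat_pow_near_of_lt_one (x := 2 * d) (y := 1 / b)
        (by linarith) hd3 (by positivity) (by rw [div_lt_one hb0]; exact hb)
      rw [one_div_pow] at hn1 hn2
      have hn0 : n₀ + 1 < n + 1 :=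
        (pow_lt_pow_iff_right₀ hb).1 (lt_of_one_div_lt_one_div (by positivity) (hn1.trans hd2))
      -- One scale is given up to make `d < 1 / (2 b ^ k)` strict, as open balls require; the
      -- diameter threshold with `n₀ + 1` keeps `k ≥ n₀`.
      obtain ⟨k, rfl⟩ : ∃ k, n = k + 1 := ⟨n - 1, by omega⟩
      have hdk : d < 1 / (2 * b ^ k) := by
        have : 1 / b ^ (k + 1) < 1 / b ^ k :=
          one_div_lt_one_div_of_lt (by positivity) (pow_lt_pow_right₀ hb (by omega))
        rw [show 1 / (2 * b ^ k) = 1 / b ^ k / 2 by ring]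
        linarith
      refine (measure_mono (hsub k hdk)).trans ((h x hxG k (by omega)).trans ?_)
      rw [ENNReal.ofReal_rpow_of_pos hpos, ← ENNReal.ofReal_mul hDpos.le]
      refine ENNReal.ofReal_le_ofReal ?_
      have hlow : (b ^ (-(t : ℝ))) ^ k ≤ ((2 * b ^ 2) * d) ^ (t : ℝ) := by
        rw [← Real.rpow_natCast, ← Real.rpow_mul hb0.le, mul_comm, Real.rpow_mul hb0.le,
          Real.rpow_natCast, Real.rpow_neg (by positivity), ← Real.inv_rpow (by positivity)]
        refine Real.rpow_le_rpow (by positivity) ?_ ht'.le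
        rw [inv_eq_one_div, div_le_iff₀ (by positivity)]
        rw [div_lt_iff₀ (by positivity)] at hn1
        calc (1 : ℝ) ≤ 2 * d * b ^ (k + 1 + 1) := hn1.le
          _ = 2 * b ^ 2 * d * b ^ k := by ring
      calc C * (b ^ (-(t : ℝ))) ^ k ≤ C * ((2 * b ^ 2) * d) ^ (t : ℝ) := by gcongr
        _ = D * d ^ (t : ℝ) := by rw [Real.mul_rpow (by positivity) hd0, hD]; ring
  have h1 := key G
  rw [h0, Measure.smul_apply, Measure.restrict_apply_self, smul_eq_mul] at h1
  have h2 := mul_eq_zero.1 (le_antisymm h1 zero_le)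
  exact h2.elim (ENNReal.inv_ne_zero.2 hDt) hμG

/-! ### Bounded distortion and the measure of balls -/

theorem abs_circleCos_sub_le (m : ℕ) (x y : UnitAddCircle) :
    |circleCos m y - circleCos m x| ≤ 2 * Real.pi * m * dist y x := by
  obtain ⟨x, rfl⟩ := QuotientAddGroup.mk_surjective x
  obtain ⟨y, rfl⟩ := QuotientAddGroup.mk_surjective y
  change |circleCos m (y : UnitAddCircle) - circleCos m (x : UnitAddCircle)|
    ≤ 2 * Real.pi * m * dist (y : UnitAddCircle) (x : UnitAddCircle)
  have hd : dist (y : UnitAddCircle) (x : UnitAddCircle) = |y - round (y - x) - x| := by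
    rw [dist_eq_norm, ← AddCircle.coe_sub, UnitAddCircle.norm_eq]
    congr 1
    ring
  have hy : (y : UnitAddCircle) = ((y - round (y - x) : ℝ) : UnitAddCircle) := by
    have h0 : ((round (y - x) : ℝ) : UnitAddCircle) = 0 :=
      (AddCircle.coe_eq_zero_iff 1).2 ⟨round (y - x), by simp⟩
    rw [AddCircle.coe_sub, h0, sub_zero]
  rw [hd, hy, circleCos_coe, circleCos_coe]
  refine (Real.abs_cos_sub_cos_le _ _).trans_eq ?_
  rw [← mul_sub, abs_mul, abs_of_nonneg (by positivity)]

/-- The logarithmic Birkhoff sums of `1 + a cos (2 π x)`, regularised by `ε`. -/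
noncomputable def rieszLogSum (a ε : ℝ) (q n : ℕ) (x : UnitAddCircle) : ℝ :=
  ∑ k ∈ Finset.range n, Real.log (1 + ε + a * circleCos (q ^ k) x)

theorem continuous_log_one_add {a : ℝ} (ha : a ∈ Set.Icc (-1 : ℝ) 1) {ε : ℝ} (hε : 0 < ε) (m : ℕ) :
    Continuous fun x => Real.log (1 + ε + a * circleCos m x) := by
  refine Continuous.log (continuous_const.add (continuous_const.mul (continuous_circleCos m)))
    fun x => ?_
  have := one_add_mul_circleCos_nonneg ha m x
  linarith

theorem continuous_rieszLogSum {a : ℝ} (ha : a ∈ Set.Icc (-1 : ℝ) 1) {ε : ℝ} (hε : 0 < ε)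
    (q n : ℕ) : Continuous (rieszLogSum a ε q n) :=
  continuous_finsetSum _ fun k _ => continuous_log_one_add ha hε (q ^ k)

theorem sum_range_pow_le {q : ℕ} (hq : 2 ≤ q) (n : ℕ) :
    ∑ k ∈ Finset.range n, (q : ℝ) ^ k ≤ (q : ℝ) ^ n := by
  have hq' : (2 : ℝ) ≤ q := by exact_mod_cast hq
  induction n with
  | zero => simp
  | succ n ih =>
    rw [Finset.sum_range_succ, pow_succ]
    have : (0 : ℝ) ≤ (q : ℝ) ^ n := by positivity
    nlinarith

/-- Distortion bound on balls of radius `1 / (2 q ^ n)`. -/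
theorem rieszDensity_le_exp_rieszLogSum {a : ℝ} (ha : a ∈ Set.Icc (-1 : ℝ) 1) {ε : ℝ} (hε : 0 < ε)
    {q : ℕ} (hq : 2 ≤ q) (n : ℕ) {x y : UnitAddCircle}
    (hxy : y ∈ Metric.ball x (1 / (2 * (q : ℝ) ^ n))) :
    rieszDensity a q n y ≤ Real.exp (Real.pi / ε + rieszLogSum a ε q n x) := by
  have hq0 : (0 : ℝ) < q := by exact_mod_cast (by omega : 0 < q)
  have hterm : ∀ k ∈ Finset.range n, 1 + a * circleCos (q ^ k) y ≤
      Real.exp (Real.pi / ε * ((q : ℝ) ^ k / (q : ℝ) ^ n)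
        + Real.log (1 + ε + a * circleCos (q ^ k) x)) := by
    intro k _
    have h0 := one_add_mul_circleCos_nonneg ha (q ^ k) x
    have h1 := abs_circleCos_sub_le (q ^ k) x y
    have hr : 2 * Real.pi * ((q ^ k : ℕ) : ℝ) * dist y x
        ≤ Real.pi * ((q : ℝ) ^ k / (q : ℝ) ^ n) := by
      have hd : dist y x ≤ 1 / (2 * (q : ℝ) ^ n) := (Metric.mem_ball.1 hxy).le
      calc 2 * Real.pi * ((q ^ k : ℕ) : ℝ) * dist y x
          ≤ 2 * Real.pi * ((q ^ k : ℕ) : ℝ) * (1 / (2 * (q : ℝ) ^ n)) := by gcongr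
        _ = Real.pi * ((q : ℝ) ^ k / (q : ℝ) ^ n) := by
          push_cast
          field_simp
    have h2 : a * circleCos (q ^ k) y - a * circleCos (q ^ k) x
        ≤ Real.pi * ((q : ℝ) ^ k / (q : ℝ) ^ n) := by
      rw [← mul_sub]
      refine (le_abs_self _).trans ?_
      rw [abs_mul]
      exact (mul_le_of_le_one_left (abs_nonneg _) (abs_le.2 ha)).trans (h1.trans hr)
    set r := Real.pi * ((q : ℝ) ^ k / (q : ℝ) ^ n) with hrdef
    have hr0 : 0 ≤ r := by positivity
    rw [Real.exp_add, Real.exp_log (by linarith)]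
    have h3 : 1 + r / ε ≤ Real.exp (Real.pi / ε * ((q : ℝ) ^ k / (q : ℝ) ^ n)) := by
      have := Real.add_one_le_exp (r / ε)
      rw [div_mul_eq_mul_div, ← hrdef]
      linarith
    have h4 : r ≤ r / ε * (1 + ε + a * circleCos (q ^ k) x) := by
      rw [div_mul_eq_mul_div, le_div_iff₀ hε]
      nlinarith
    calc 1 + a * circleCos (q ^ k) y ≤ (1 + r / ε) * (1 + ε + a * circleCos (q ^ k) x) := by
          linarith
      _ ≤ _ := mul_le_mul_of_nonneg_right h3 (by linarith)
  refine (Finset.prod_le_prod (fun k _ => one_add_mul_circleCos_nonneg ha (q ^ k) y)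
    hterm).trans ?_
  rw [← Real.exp_sum, Real.exp_le_exp, Finset.sum_add_distrib, ← Finset.mul_sum, ← Finset.sum_div]
  refine add_le_add_left ?_ _
  refine mul_le_of_le_one_right (by positivity) ?_
  rw [div_le_one (by positivity)]
  exact sum_range_pow_le hq n

theorem one_div_le_dist_circleRat {Q : ℕ} {i j : ℕ} (hi : i < Q) (hj : j < Q) (hij : i ≠ j) :
    1 / (Q : ℝ) ≤ dist (circleRat Q i) (circleRat Q j) := by
  have hQ : (0 : ℝ) < Q := by exact_mod_cast (by omega : 0 < Q)
  rw [dist_eq_norm, circleRat, circleRat, ← AddCircle.coe_sub, UnitAddCircle.norm_eq]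
  set r := round ((i : ℝ) / Q - j / Q)
  have h : (i : ℝ) / Q - j / Q - r = (((i : ℤ) - j - r * Q : ℤ) : ℝ) / Q := by
    push_cast
    field_simp
  rw [h, abs_div, abs_of_pos hQ]
  gcongr
  rw [← Int.cast_abs]
  have hne : (i : ℤ) - j - r * Q ≠ 0 := by
    intro h0
    have hdvd : (Q : ℤ) ∣ (i : ℤ) - j := ⟨r, by linarith⟩
    have := Int.eq_zero_of_abs_lt_dvd hdvd (by rw [abs_lt]; omega)
    omega
  exact_mod_cast Int.one_le_abs hne

/-- The fibre points are `1 / Q` apart, while two points of the ball are strictly closer than that.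
-/
theorem sum_indicator_ball_le {Q : ℕ} (c x : UnitAddCircle) :
    ∑ j ∈ Finset.range Q, (Metric.ball c (1 / (2 * (Q : ℝ)))).indicator
      (fun _ => (1 : ℝ≥0∞)) (x + circleRat Q j) ≤ 1 := by
  classical
  simp only [Set.indicator_apply]
  rw [← Finset.sum_filter, Finset.sum_const, nsmul_one]
  have : (Finset.filter (fun j => x + circleRat Q j ∈ Metric.ball c (1 / (2 * (Q : ℝ))))
      (Finset.range Q)).card ≤ 1 := by
    rw [Finset.card_le_one]
    intro i hi j hj
    by_contra hij
    simp only [Finset.mem_filter, Finset.mem_range, Metric.mem_ball] at hi hj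
    have h1 := one_div_le_dist_circleRat hi.1 hj.1 hij
    have h2 := dist_triangle_right (x + circleRat Q i) (x + circleRat Q j) c
    rw [dist_add_left] at h2
    have h3 : 1 / (2 * (Q : ℝ)) + 1 / (2 * (Q : ℝ)) = 1 / Q := by ring
    linarith [hi.2, hj.2]
  exact_mod_cast this

/-- Distortion bounds the first `n` factors by a constant on the ball; the others form a function of
`q ^ n • y` with integral one, and the ball's indicator has fibre average at most `q⁻ⁿ`. -/
theorem rieszProduct_ball_le {a : ℝ} (ha : a ∈ Set.Icc (-1 : ℝ) 1) {ε : ℝ} (hε : 0 < ε)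
    {q : ℕ} (hq : 3 ≤ q) (n : ℕ) (x : UnitAddCircle) :
    (rieszProduct a q : Measure UnitAddCircle) (Metric.ball x (1 / (2 * (q : ℝ) ^ n)))
      ≤ ENNReal.ofReal (Real.exp (Real.pi / ε + rieszLogSum a ε q n x) / (q : ℝ) ^ n) := by
  have hq0 : 0 < q := by omega
  have hqn : (0 : ℝ) < (q : ℝ) ^ n := by positivity
  refine rieszProduct_open_le ha hq Metric.isOpen_ball (n := n) fun m => ?_
  set B := Metric.ball x (1 / (2 * (q : ℝ) ^ n)) with hB
  set D := Real.exp (Real.pi / ε + rieszLogSum a ε q n x) with hD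
  have hBm : MeasurableSet B := measurableSet_ball
  rw [rieszPartial_apply a q _ hBm, ← lintegral_indicator hBm]
  have hmp := measurePreserving_nsmul_circle (pow_pos hq0 n)
  have hmm : Measurable fun y : UnitAddCircle => ENNReal.ofReal (rieszDensity a q m (q ^ n • y)) :=
    (measurable_ofReal_rieszDensity a q m).comp hmp.measurable
  calc ∫⁻ y, B.indicator (fun y => ENNReal.ofReal (rieszDensity a q (n + m) y)) y
      ≤ ∫⁻ y, ENNReal.ofReal D * (B.indicator (fun _ => (1 : ℝ≥0∞)) y *
          ENNReal.ofReal (rieszDensity a q m (q ^ n • y))) := by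
        refine lintegral_mono fun y => ?_
        by_cases hy : y ∈ B
        · simp only [Set.indicator_of_mem hy, one_mul]
          rw [rieszDensity_add, ENNReal.ofReal_mul (rieszDensity_nonneg ha q n y)]
          gcongr
          exact rieszDensity_le_exp_rieszLogSum ha hε (by omega) n hy
        · simp [Set.indicator_of_notMem hy]
    _ = ENNReal.ofReal D * ∫⁻ y, B.indicator (fun _ => (1 : ℝ≥0∞)) y *
          ENNReal.ofReal (rieszDensity a q m (q ^ n • y)) :=
        lintegral_const_mul _ ((measurable_const.indicator hBm).mul hmm)
    _ ≤ ENNReal.ofReal D * (ENNReal.ofReal (1 / (q : ℝ) ^ n) *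
          ∫⁻ y, ENNReal.ofReal (rieszDensity a q m y)) := by
        gcongr
        refine lintegral_mul_comp_nsmul_le (pow_pos hq0 n) (measurable_const.indicator hBm)
          (measurable_ofReal_rieszDensity a q m) fun y => ?_
        have h1 : ((q ^ n : ℕ) : ℝ≥0∞) * ENNReal.ofReal (1 / (q : ℝ) ^ n) = 1 := by
          rw [← ENNReal.ofReal_natCast, ← ENNReal.ofReal_mul (by positivity)]
          push_cast
          rw [mul_one_div_cancel hqn.ne', ENNReal.ofReal_one]
        rw [h1]
        have := sum_indicator_ball_le (Q := q ^ n) x y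
        push_cast at this
        exact this
    _ = ENNReal.ofReal (D / (q : ℝ) ^ n) := by
        rw [lintegral_rieszDensity ha hq, mul_one, ← ENNReal.ofReal_mul (by positivity),
          mul_one_div]

/-! ### Large deviations of the logarithmic sums -/

/-- Exponential Chebyshev bound for the superlevel sets of the logarithmic sums. -/
theorem rieszProduct_superlevel_le {a : ℝ} (ha : a ∈ Set.Icc (-1 : ℝ) 1) {ε : ℝ} (hε : 0 < ε)
    {q : ℕ} (hq : 3 ≤ q) {θ lam Λ : ℝ} (hθ : 0 < θ) (hΛ : 0 ≤ Λ)
    (h : ∀ x, ∑ j ∈ Finset.range q, (1 + a * circleCos 1 (x + circleRat q j)) *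
      Real.exp (θ * Real.log (1 + ε + a * circleCos 1 (x + circleRat q j))) ≤ q * Λ) (n : ℕ) :
    (rieszProduct a q : Measure UnitAddCircle) {x | n * lam < rieszLogSum a ε q n x}
      ≤ ENNReal.ofReal (Λ * Real.exp (-(θ * lam))) ^ n := by
  have hq0 : 0 < q := by omega
  have hUo : IsOpen {x | n * lam < rieszLogSum a ε q n x} :=
    isOpen_lt continuous_const (continuous_rieszLogSum ha hε q n)
  refine rieszProduct_open_le ha hq hUo (n := n) fun m => ?_
  set U := {x | n * lam < rieszLogSum a ε q n x} with hU
  rw [rieszPartial_apply a q _ hUo.measurableSet, ← lintegral_indicator hUo.measurableSet]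
  -- The exponentially tilted factor: its product along the orbit is the density times `exp (θ
  -- S_n)`.
  set w : UnitAddCircle → ℝ := fun x => (1 + a * circleCos 1 x) *
      Real.exp (θ * Real.log (1 + ε + a * circleCos 1 x)) with hw
  have hw0 : ∀ x, 0 ≤ w x := fun x =>
    mul_nonneg (one_add_mul_circleCos_nonneg ha 1 x) (Real.exp_pos _).le
  have hwc : Continuous w := by
    refine Continuous.mul ?_ ?_
    · exact continuous_const.add (continuous_const.mul (continuous_circleCos 1))
    · exact Real.continuous_exp.comp (continuous_const.mul (continuous_log_one_add ha hε 1))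
  have hwm : Measurable fun x => ENNReal.ofReal (w x) := hwc.measurable.ennreal_ofReal
  have hsmul : ∀ k : ℕ, Measurable fun x : UnitAddCircle => q ^ k • x := fun k =>
    (measurePreserving_nsmul_circle (pow_pos hq0 k)).measurable
  have hprod : ∀ x, ∏ k ∈ Finset.range n, w (q ^ k • x)
      = rieszDensity a q n x * Real.exp (θ * rieszLogSum a ε q n x) := by
    intro x
    simp only [hw, Finset.prod_mul_distrib, rieszDensity, rieszLogSum, Finset.mul_sum,
      Real.exp_sum, ← circleCos_mul, one_mul]
  calc ∫⁻ x, U.indicator (fun x => ENNReal.ofReal (rieszDensity a q (n + m) x)) x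
      ≤ ∫⁻ x, ENNReal.ofReal (Real.exp (-(θ * (n * lam)))) *
          ((∏ k ∈ Finset.range n, ENNReal.ofReal (w (q ^ k • x))) *
            ENNReal.ofReal (rieszDensity a q m (q ^ n • x))) := by
        refine lintegral_mono fun x => ?_
        by_cases hx : x ∈ U
        · simp only [Set.indicator_of_mem hx]
          rw [← ENNReal.ofReal_prod_of_nonneg fun k _ => hw0 _, hprod, rieszDensity_add,
            ENNReal.ofReal_mul (rieszDensity_nonneg ha q n x), ← mul_assoc,
            ← ENNReal.ofReal_mul (Real.exp_pos _).le]
          gcongr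
          have h1 : 1 ≤ Real.exp (-(θ * (n * lam))) * Real.exp (θ * rieszLogSum a ε q n x) := by
            rw [← Real.exp_add, Real.one_le_exp_iff]
            have : n * lam < rieszLogSum a ε q n x := hx
            nlinarith
          have h2 := rieszDensity_nonneg ha q n x
          nlinarith
        · simp [Set.indicator_of_notMem hx]
    _ = ENNReal.ofReal (Real.exp (-(θ * (n * lam)))) *
          ∫⁻ x, (∏ k ∈ Finset.range n, ENNReal.ofReal (w (q ^ k • x))) *
            ENNReal.ofReal (rieszDensity a q m (q ^ n • x)) :=
        lintegral_const_mul _ ((Finset.measurable_fun_prod _ fun k _ => hwm.comp (hsmul k)).mul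
          ((measurable_ofReal_rieszDensity a q m).comp (hsmul n)))
    _ ≤ ENNReal.ofReal (Real.exp (-(θ * (n * lam)))) * (ENNReal.ofReal Λ ^ n *
          ∫⁻ x, ENNReal.ofReal (rieszDensity a q m x)) := by
        gcongr
        refine lintegral_prod_mul_comp_nsmul_le hq0 hwm (measurable_ofReal_rieszDensity a q m)
          (fun x => ?_) n
        rw [← ENNReal.ofReal_sum_of_nonneg fun j _ => hw0 _, ← ENNReal.ofReal_natCast,
          ← ENNReal.ofReal_mul (by positivity)]
        exact ENNReal.ofReal_le_ofReal (h x)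
    _ = ENNReal.ofReal (Λ * Real.exp (-(θ * lam))) ^ n := by
        rw [lintegral_rieszDensity ha hq, mul_one, ← ENNReal.ofReal_pow hΛ,
          ← ENNReal.ofReal_pow (by positivity), ← ENNReal.ofReal_mul (Real.exp_pos _).le, mul_pow,
          ← Real.exp_nat_mul, mul_comm]
        congr 3
        ring_nf

/-! ### Riemann sums and the entropy integral -/

/-- Riemann sums of a periodic Lipschitz function. -/
theorem sum_le_integral_add_of_lipschitz {f : ℝ → ℝ} {K : ℝ} (hf : Continuous f)
    (hper : Function.Periodic f 1) (hK : ∀ x y, |f x - f y| ≤ K * |x - y|) {q : ℕ} (hq : 0 < q)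
    (x : ℝ) : ∑ j ∈ Finset.range q, f (x + (j : ℝ) / q) ≤ q * (∫ u in (0 : ℝ)..1, f u) + K := by
  have hq0 : (0 : ℝ) < q := by exact_mod_cast hq
  have hint : ∀ s t : ℝ, IntervalIntegrable f volume s t := fun s t => hf.intervalIntegrable s t
  have hsum : ∑ j ∈ Finset.range q, ∫ u in (x + (j : ℝ) / q)..(x + ((j + 1 : ℕ) : ℝ) / q), f u
      = ∫ u in (0 : ℝ)..1, f u := by
    rw [intervalIntegral.sum_integral_adjacent_intervals
      (a := fun j : ℕ => x + (j : ℝ) / q) fun j _ => hint _ _]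
    have := hper.intervalIntegral_add_eq x 0
    rw [zero_add] at this
    simpa [div_self hq0.ne'] using this
  have hterm : ∀ j ∈ Finset.range q, f (x + (j : ℝ) / q) ≤
      q * (∫ u in (x + (j : ℝ) / q)..(x + ((j + 1 : ℕ) : ℝ) / q), f u) + K / q := by
    intro j _
    set s := x + (j : ℝ) / q with hs
    have ht : x + ((j + 1 : ℕ) : ℝ) / q = s + 1 / q := by rw [hs]; push_cast; ring
    rw [ht]
    have hK0 : 0 ≤ K := by simpa using (abs_nonneg _).trans (hK 1 0)
    have h1 : ∫ u in s..(s + 1 / q), (f s - K / q) ≤ ∫ u in s..(s + 1 / q), f u := by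
      refine intervalIntegral.integral_mono_on (by simp) (by simp) (hint _ _) fun u hu => ?_
      have h2 := (le_abs_self _).trans (hK s u)
      have h3 : |s - u| ≤ 1 / q := by
        rw [abs_sub_comm, abs_of_nonneg (by linarith [hu.1])]
        linarith [hu.2]
      have h4 : K * |s - u| ≤ K / q := by
        rw [div_eq_mul_one_div]
        gcongr
      linarith
    rw [intervalIntegral.integral_const, add_sub_cancel_left, smul_eq_mul, one_div,
      inv_mul_le_iff₀ hq0] at h1
    rw [one_div]
    linarith
  refine (Finset.sum_le_sum hterm).trans_eq ?_
  rw [Finset.sum_add_distrib, ← Finset.mul_sum, hsum, Finset.sum_const, Finset.card_range,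
    nsmul_eq_mul, mul_div_cancel₀ _ hq0.ne']

/-- Write `sin² y = (1 - cos 2y) / 2`. The `cos 2y` part follows from the primitive `cos y sin y log
(sin y)` of `cos 2y log (sin y) + cos² y`, which vanishes at both ends. -/
theorem integral_sin_sq_mul_log_sin :
    ∫ y in (0 : ℝ)..Real.pi, Real.sin y ^ 2 * Real.log (Real.sin y)
      = Real.pi / 4 - Real.pi / 2 * Real.log 2 := by
  have hc : Continuous fun y => Real.cos y * (Real.sin y * Real.log (Real.sin y)) :=
    Real.continuous_cos.mul (Real.continuous_mul_log.comp Real.continuous_sin)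
  have hlog : IntervalIntegrable (fun y => Real.log (Real.sin y)) volume 0 Real.pi :=
    intervalIntegrable_log_sin
  have hlog2 : IntervalIntegrable (fun y => Real.cos (2 * y) * Real.log (Real.sin y))
      volume 0 Real.pi :=
    hlog.continuousOn_mul (by fun_prop)
  have hcos : IntervalIntegrable (fun y => Real.cos y ^ 2) volume 0 Real.pi :=
    (by fun_prop : Continuous fun y => Real.cos y ^ 2).intervalIntegrable _ _
  have h1 : ∫ y in (0 : ℝ)..Real.pi, (Real.cos (2 * y) * Real.log (Real.sin y) + Real.cos y ^ 2)
      = 0 := by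
    rw [intervalIntegral.integral_eq_sub_of_hasDerivAt_of_le Real.pi_pos.le
      (f := fun y => Real.cos y * (Real.sin y * Real.log (Real.sin y))) hc.continuousOn ?_
      (hlog2.add hcos)]
    · simp
    · intro y hy
      have hs : Real.sin y ≠ 0 := (Real.sin_pos_of_mem_Ioo hy).ne'
      have := (Real.hasDerivAt_cos y).mul
        ((Real.hasDerivAt_sin y).mul ((Real.hasDerivAt_sin y).log hs))
      refine this.congr_deriv ?_
      rw [Real.cos_two_mul', Pi.mul_apply]
      field_simp
      ring
  rw [intervalIntegral.integral_add hlog2 hcos, integral_cos_sq] at h1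
  have h2 : ∀ y, Real.sin y ^ 2 * Real.log (Real.sin y)
      = 1 / 2 * Real.log (Real.sin y) - 1 / 2 * (Real.cos (2 * y) * Real.log (Real.sin y)) := by
    intro y
    rw [Real.cos_two_mul, Real.cos_sq']
    ring
  simp only [h2]
  rw [intervalIntegral.integral_sub (hlog.const_mul _) (hlog2.const_mul _),
    intervalIntegral.integral_const_mul, intervalIntegral.integral_const_mul,
    integral_log_sin_zero_pi]
  simp at h1
  linarith

/-- The entropy integral of `1 - cos (2 π u)`. -/
theorem integral_mul_log_one_sub_cos :
    ∫ u in (0 : ℝ)..1, (1 - Real.cos (2 * Real.pi * u)) * Real.log (1 - Real.cos (2 * Real.pi * u))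
      = 1 - Real.log 2 := by
  have hpi := Real.pi_pos
  have h1 : ∀ u ∈ Set.uIcc (0 : ℝ) 1,
      (1 - Real.cos (2 * Real.pi * u)) * Real.log (1 - Real.cos (2 * Real.pi * u))
      = (fun y => 2 * Real.log 2 * Real.sin y ^ 2 + 4 * (Real.sin y ^ 2 * Real.log (Real.sin y)))
        (Real.pi * u) := by
    intro u _
    have h2 : 1 - Real.cos (2 * Real.pi * u) = 2 * Real.sin (Real.pi * u) ^ 2 := by
      rw [mul_assoc, Real.cos_two_mul, Real.cos_sq']
      ring
    simp only [h2]
    rcases eq_or_ne (Real.sin (Real.pi * u)) 0 with h0 | h0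
    · simp [h0]
    · rw [Real.log_mul two_ne_zero (pow_ne_zero 2 h0), Real.log_pow]
      push_cast
      ring
  have hc : Continuous fun y => Real.sin y ^ 2 * Real.log (Real.sin y) := by
    have : (fun y => Real.sin y ^ 2 * Real.log (Real.sin y))
        = fun y => Real.sin y * (Real.sin y * Real.log (Real.sin y)) := by ext y; ring
    rw [this]
    exact Real.continuous_sin.mul (Real.continuous_mul_log.comp Real.continuous_sin)
  rw [intervalIntegral.integral_congr h1, intervalIntegral.integral_comp_mul_left
    (fun y => 2 * Real.log 2 * Real.sin y ^ 2 + 4 * (Real.sin y ^ 2 * Real.log (Real.sin y)))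
    hpi.ne',
    mul_zero, mul_one, intervalIntegral.integral_add
    ((by fun_prop : Continuous fun y => 2 * Real.log 2 * Real.sin y ^ 2).intervalIntegrable _ _)
    ((hc.const_mul 4).intervalIntegrable _ _), intervalIntegral.integral_const_mul,
    intervalIntegral.integral_const_mul, integral_sin_sq_mul_log_sin, integral_sin_sq]
  simp
  field_simp
  ring

theorem integral_mul_log_one_add_cos :
    ∫ u in (0 : ℝ)..1, (1 + Real.cos (2 * Real.pi * u)) * Real.log (1 + Real.cos (2 * Real.pi * u))
      = 1 - Real.log 2 := by
  set F : ℝ → ℝ := fun u =>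
    (1 - Real.cos (2 * Real.pi * u)) * Real.log (1 - Real.cos (2 * Real.pi * u)) with hF
  have hper : Function.Periodic F 1 := by
    intro u
    simp only [hF, mul_add, mul_one, Real.cos_add_two_pi]
  have h : ∀ u, (1 + Real.cos (2 * Real.pi * u)) * Real.log (1 + Real.cos (2 * Real.pi * u))
      = F (u + 1 / 2) := by
    intro u
    have : 2 * Real.pi * (u + 1 / 2) = 2 * Real.pi * u + Real.pi := by ring
    simp only [hF, this, Real.cos_add_pi, sub_neg_eq_add]
  simp only [h]
  rw [intervalIntegral.integral_comp_add_right, ← integral_mul_log_one_sub_cos]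
  have := hper.intervalIntegral_add_eq (1 / 2) 0
  rw [zero_add] at this
  rw [← this]
  norm_num

theorem mul_log_add_le {t ε : ℝ} (ht : 0 ≤ t) (hε : 0 < ε) :
    t * Real.log (t + ε) ≤ t * Real.log t + ε := by
  rcases ht.eq_or_lt with rfl | ht
  · simpa using hε.le
  · have h1 : Real.log (t + ε) - Real.log t ≤ ε / t := by
      rw [← Real.log_div (by linarith) ht.ne']
      refine (Real.log_le_sub_one_of_pos (by positivity)).trans_eq ?_
      field_simp
      ring
    have h2 : t * (Real.log (t + ε) - Real.log t) ≤ ε := by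
      calc _ ≤ t * (ε / t) := by gcongr
        _ = ε := mul_div_cancel₀ _ ht.ne'
    linarith

theorem one_add_mul_cos_nonneg {a : ℝ} (ha : a ∈ Set.Icc (-1 : ℝ) 1) (y : ℝ) :
    0 ≤ 1 + a * Real.cos y := by
  have h : |a * Real.cos y| ≤ 1 := by
    rw [abs_mul]
    exact mul_le_one₀ (abs_le.2 ha) (abs_nonneg _) (Real.abs_cos_le_one y)
  linarith [(abs_le.1 h).1]

/-- Since `1 + a s` is a convex combination of `1 + s` and `1 - s`, convexity of `t log t` reduces
to `a = ±1`; the shift costs at most `ε`. -/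
theorem integral_mul_log_one_add_mul_cos_le {a : ℝ} (ha : a ∈ Set.Icc (-1 : ℝ) 1) {ε : ℝ}
    (hε : 0 < ε) :
    ∫ u in (0 : ℝ)..1, (1 + a * Real.cos (2 * Real.pi * u)) *
      Real.log (1 + a * Real.cos (2 * Real.pi * u) + ε) ≤ 1 - Real.log 2 + ε := by
  have hc : ∀ b : ℝ, Continuous fun u : ℝ => 1 + b * Real.cos (2 * Real.pi * u) := fun b => by
    fun_prop
  have hcp : Continuous fun u : ℝ => (1 + Real.cos (2 * Real.pi * u)) *
      Real.log (1 + Real.cos (2 * Real.pi * u)) :=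
    Real.continuous_mul_log.comp (by fun_prop : Continuous fun u : ℝ => 1 + Real.cos (2 * Real.pi * u))
  have hcm : Continuous fun u : ℝ => (1 - Real.cos (2 * Real.pi * u)) *
      Real.log (1 - Real.cos (2 * Real.pi * u)) :=
    Real.continuous_mul_log.comp (by fun_prop : Continuous fun u : ℝ => 1 - Real.cos (2 * Real.pi * u))
  have hcε : Continuous fun u : ℝ => (1 + a * Real.cos (2 * Real.pi * u)) *
      Real.log (1 + a * Real.cos (2 * Real.pi * u) + ε) :=
    (hc a).mul (Continuous.log (by fun_prop) fun u => by
      linarith [one_add_mul_cos_nonneg ha (2 * Real.pi * u)])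
  have hle : ∀ u ∈ Set.Icc (0 : ℝ) 1, (1 + a * Real.cos (2 * Real.pi * u)) *
      Real.log (1 + a * Real.cos (2 * Real.pi * u) + ε) ≤
      ((1 + a) / 2) * ((1 + Real.cos (2 * Real.pi * u)) *
        Real.log (1 + Real.cos (2 * Real.pi * u))) +
      ((1 - a) / 2) * ((1 - Real.cos (2 * Real.pi * u)) *
        Real.log (1 - Real.cos (2 * Real.pi * u))) + ε := by
    intro u _
    refine (mul_log_add_le (one_add_mul_cos_nonneg ha _) hε).trans (add_le_add_left ?_ ε)
    set s := Real.cos (2 * Real.pi * u)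
    have h1 : (1 + s) ∈ Set.Ici (0 : ℝ) := by
      simp only [Set.mem_Ici]; linarith [Real.neg_one_le_cos (2 * Real.pi * u)]
    have h2 : (1 - s) ∈ Set.Ici (0 : ℝ) := by
      simp only [Set.mem_Ici]; linarith [Real.cos_le_one (2 * Real.pi * u)]
    have h := Real.convexOn_mul_log.2 h1 h2 (by linarith [ha.1] : 0 ≤ (1 + a) / 2)
      (by linarith [ha.2] : 0 ≤ (1 - a) / 2) (by ring)
    simp only [smul_eq_mul] at h
    rwa [show (1 + a) / 2 * (1 + s) + (1 - a) / 2 * (1 - s) = 1 + a * s by ring] at h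
  have hi1 := (hcp.const_mul ((1 + a) / 2)).intervalIntegrable (μ := volume) 0 1
  have hi2 := (hcm.const_mul ((1 - a) / 2)).intervalIntegrable (μ := volume) 0 1
  refine (intervalIntegral.integral_mono_on zero_le_one (hcε.intervalIntegrable _ _)
    ((hi1.add hi2).add intervalIntegrable_const) hle).trans_eq ?_
  rw [intervalIntegral.integral_add (hi1.add hi2) intervalIntegrable_const,
    intervalIntegral.integral_add hi1 hi2, intervalIntegral.integral_const_mul,
    intervalIntegral.integral_const_mul, integral_mul_log_one_add_cos,
    integral_mul_log_one_sub_cos, intervalIntegral.integral_const]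
  simp
  ring

/-- With `w = √t`, the hypothesis gives `r ≤ √2 w ≤ 3 w / 2`, and `-log w ≤ 1 / (e w)` cancels the
factor `w`. -/
theorem neg_log_mul_le {t r : ℝ} (ht : 0 ≤ t) (hr : 0 ≤ r) (hrt : r ^ 2 ≤ 2 * t) :
    r * -Real.log t ≤ 2 := by
  rcases ht.eq_or_lt with rfl | ht
  · simp
  set w := Real.sqrt t with hw
  have hw0 : 0 < w := Real.sqrt_pos.2 ht
  have hw2 : w ^ 2 = t := Real.sq_sqrt ht.le
  have hrw : r ≤ 3 / 2 * w := by
    refine le_of_sq_le_sq ?_ (by positivity)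
    nlinarith
  have hl : Real.log t = 2 * Real.log w := by rw [← hw2, Real.log_pow]; norm_num
  have he : (2 : ℝ) < Real.exp 1 := by linarith [Real.exp_one_gt_d9]
  have h1 : -Real.log w ≤ 1 / (Real.exp 1 * w) := by
    have h2 := Real.log_le_sub_one_of_pos (x := 1 / (Real.exp 1 * w)) (by positivity)
    rw [one_div, Real.log_inv, Real.log_mul (Real.exp_pos 1).ne' hw0.ne', Real.log_exp,
      ← one_div] at h2
    linarith
  calc r * -Real.log t = 2 * (r * -Real.log w) := by rw [hl]; ring
    _ ≤ 2 * (r * (1 / (Real.exp 1 * w))) := by gcongr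
    _ ≤ 2 * (3 / 2 * w * (1 / (Real.exp 1 * w))) := by gcongr
    _ = 3 / Real.exp 1 := by field_simp
    _ ≤ 2 := by
      rw [div_le_iff₀ (Real.exp_pos 1)]
      linarith

/-- This is, up to the factor `-2 π`, the derivative of the summand below, so it yields the
Lipschitz constant `4 π`. Where the logarithm is very negative, `(a sin y)² ≤ t (2 - t) ≤ 2 t`
compensates. -/
theorem abs_mul_sin_mul_log_le {a : ℝ} (ha : a ∈ Set.Icc (-1 : ℝ) 1) {ε : ℝ} (hε : 0 < ε)
    (hε1 : ε ≤ 1 / 2) (y : ℝ) : |a * Real.sin y * (Real.log (1 + a * Real.cos y + ε)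
      + (1 + a * Real.cos y) / (1 + a * Real.cos y + ε))| ≤ 2 := by
  set t := 1 + a * Real.cos y with ht
  have ht0 : 0 ≤ t := one_add_mul_cos_nonneg ha y
  have ha2 : a ^ 2 ≤ 1 := by nlinarith [ha.1, ha.2]
  have hσ : |a * Real.sin y| ^ 2 ≤ t * (2 - t) := by
    rw [sq_abs, ht]
    nlinarith [Real.sin_sq_add_cos_sq y]
  have hσ1 : |a * Real.sin y| ≤ 1 := by
    refine le_of_sq_le_sq ?_ zero_le_one
    nlinarith [sq_nonneg (t - 1)]
  have ht2 : t ≤ 2 := by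
    by_contra h
    nlinarith [sq_nonneg |a * Real.sin y|]
  have hσ0 := abs_nonneg (a * Real.sin y)
  have hup : Real.log (t + ε) + t / (t + ε) ≤ 2 := by
    have h1 : Real.log (t + ε) ≤ 1 := by
      rw [Real.log_le_iff_le_exp (by linarith)]
      linarith [Real.exp_one_gt_d9]
    have h2 : t / (t + ε) ≤ 1 := by
      rw [div_le_one (by linarith)]
      linarith
    linarith
  have hlow : -Real.log (t + ε) ≥ -(Real.log (t + ε) + t / (t + ε)) := by
    have : 0 ≤ t / (t + ε) := by positivity
    linarith
  have h3 := neg_log_mul_le (t := t + ε) (by linarith) hσ0 (by nlinarith)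
  rw [abs_mul]
  rcases abs_cases (Real.log (t + ε) + t / (t + ε)) with ⟨h, _⟩ | ⟨h, _⟩ <;> rw [h] <;> nlinarith

theorem sum_mul_log_circleCos_le {a : ℝ} (ha : a ∈ Set.Icc (-1 : ℝ) 1) {ε : ℝ} (hε : 0 < ε)
    (hε1 : ε ≤ 1 / 2) {q : ℕ} (hq : 0 < q) (x : UnitAddCircle) :
    ∑ j ∈ Finset.range q, (1 + a * circleCos 1 (x + circleRat q j)) *
      Real.log (1 + ε + a * circleCos 1 (x + circleRat q j))
      ≤ q * (1 - Real.log 2 + ε) + 4 * Real.pi := by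
  obtain ⟨x, rfl⟩ := QuotientAddGroup.mk_surjective x
  set f : ℝ → ℝ := fun u => (1 + a * Real.cos (2 * Real.pi * u)) *
      Real.log (1 + a * Real.cos (2 * Real.pi * u) + ε) with hf
  have hd : ∀ u, HasDerivAt f (-(2 * Real.pi) * (a * Real.sin (2 * Real.pi * u) *
      (Real.log (1 + a * Real.cos (2 * Real.pi * u) + ε) + (1 + a * Real.cos (2 * Real.pi * u)) /
        (1 + a * Real.cos (2 * Real.pi * u) + ε)))) u := by
    intro u
    have hpos := one_add_mul_cos_nonneg ha (2 * Real.pi * u)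
    have h1 : HasDerivAt (fun u : ℝ => 1 + a * Real.cos (2 * Real.pi * u))
        (a * (-Real.sin (2 * Real.pi * u) * (2 * Real.pi))) u := by
      have := (((hasDerivAt_id u).const_mul (2 * Real.pi)).cos.const_mul a).const_add 1
      simpa using this
    have h2 := h1.mul ((h1.add_const ε).log (by linarith))
    refine h2.congr_deriv ?_
    have : 1 + a * Real.cos (2 * Real.pi * u) + ε ≠ 0 := by linarith
    field_simp
    ring
  have hdiff : Differentiable ℝ f := fun u => (hd u).differentiableAt
  have hlip : ∀ u v, |f u - f v| ≤ 4 * Real.pi * |u - v| := by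
    intro u v
    have := Convex.norm_image_sub_le_of_norm_hasDerivWithin_le (f := f) (s := Set.univ)
      (C := 4 * Real.pi) (fun w _ => (hd w).hasDerivWithinAt) (fun w _ => ?_) convex_univ
      (Set.mem_univ v) (Set.mem_univ u)
    · simpa using this
    · rw [Real.norm_eq_abs, abs_mul, abs_neg, abs_of_pos Real.two_pi_pos]
      nlinarith [abs_mul_sin_mul_log_le ha hε hε1 (2 * Real.pi * w), Real.pi_pos]
  have hper : Function.Periodic f 1 := by
    intro u
    simp only [hf, mul_add, mul_one, Real.cos_add_two_pi]
  have h := sum_le_integral_add_of_lipschitz hdiff.continuous hper hlip hq x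
  have hI := integral_mul_log_one_add_mul_cos_le ha hε
  have hq0 : (0 : ℝ) ≤ q := by positivity
  refine le_trans (le_of_eq (Finset.sum_congr rfl fun j _ => ?_))
    (h.trans (add_le_add_left (mul_le_mul_of_nonneg_left hI hq0) _))
  have hx : (QuotientAddGroup.mk x : UnitAddCircle) + circleRat q j
      = ((x + (j : ℝ) / q : ℝ) : UnitAddCircle) := (AddCircle.coe_add 1 _ _).symm
  rw [hx, circleCos_coe]
  simp only [hf, Nat.cast_one, mul_one]
  rw [add_right_comm]

theorem sum_circleCos_circleRat {q : ℕ} (hq : 2 ≤ q) (x : UnitAddCircle) :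
    ∑ j ∈ Finset.range q, circleCos 1 (x + circleRat q j) = 0 := by
  have hprim := Complex.isPrimitiveRoot_exp q (by omega)
  have h : ∀ j, fourier 1 (x + circleRat q j)
      = fourier 1 x * Complex.exp (2 * Real.pi * Complex.I / q) ^ j := by
    intro j
    rw [fourier_one, fourier_one, AddCircle.toCircle_add, Circle.coe_mul, ← fourier_one
      (x := circleRat q j), circleRat, fourier_coe_apply, ← Complex.exp_nat_mul]
    congr 2
    push_cast
    ring
  simp only [circleCos, Nat.cast_one, h]
  rw [← Complex.re_sum, ← Finset.mul_sum, hprim.geom_sum_eq_zero (by omega)]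
  simp

/-- The logarithm is bounded by `M` in absolute value, so `exp z ≤ 1 + z + z²` for `|z| ≤ 1`
applies; the weights `1 + a cos` sum to `q` because the cosines cancel over a fibre. -/
theorem sum_mul_exp_log_le {a : ℝ} (ha : a ∈ Set.Icc (-1 : ℝ) 1) {ε : ℝ} (hε : 0 < ε)
    (hε1 : ε ≤ 1 / 2) {q : ℕ} (hq : 2 ≤ q) {θ M : ℝ} (hθ : 0 < θ) (hM : 1 - Real.log ε ≤ M)
    (hM1 : 1 ≤ M) (hθM : θ * M ≤ 1) (x : UnitAddCircle) :
    ∑ j ∈ Finset.range q, (1 + a * circleCos 1 (x + circleRat q j)) *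
      Real.exp (θ * Real.log (1 + ε + a * circleCos 1 (x + circleRat q j)))
      ≤ q * (1 + θ * (1 - Real.log 2 + 4 * Real.pi / q + ε) + (θ * M) ^ 2) := by
  have hq0 : (0 : ℝ) < q := by exact_mod_cast (by omega : 0 < q)
  have hterm : ∀ j ∈ Finset.range q, (1 + a * circleCos 1 (x + circleRat q j)) *
      Real.exp (θ * Real.log (1 + ε + a * circleCos 1 (x + circleRat q j)))
      ≤ (1 + (θ * M) ^ 2) * (1 + a * circleCos 1 (x + circleRat q j)) +
        θ * ((1 + a * circleCos 1 (x + circleRat q j)) *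
          Real.log (1 + ε + a * circleCos 1 (x + circleRat q j))) := by
    intro j _
    set c := circleCos 1 (x + circleRat q j)
    have h0 : 0 ≤ 1 + a * c := one_add_mul_circleCos_nonneg ha 1 _
    have h2 : 1 + a * c ≤ 2 := by
      have h1 : |a * c| ≤ 1 := by
        rw [abs_mul]
        exact mul_le_one₀ (abs_le.2 ha) (abs_nonneg _) (abs_circleCos_le 1 _)
      linarith [(abs_le.1 h1).2]
    have hup : Real.log (1 + ε + a * c) ≤ 1 := by
      rw [Real.log_le_iff_le_exp (by linarith)]
      linarith [Real.exp_one_gt_d9]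
    have hlow : Real.log ε ≤ Real.log (1 + ε + a * c) := Real.log_le_log hε (by linarith)
    set L := Real.log (1 + ε + a * c)
    have hL : |L| ≤ M := abs_le.2 ⟨by linarith, by linarith⟩
    have hθL : |θ * L| ≤ θ * M := by
      rw [abs_mul, abs_of_pos hθ]
      gcongr
    have he := (abs_le.1 (Real.abs_exp_sub_one_sub_id_le (hθL.trans hθM))).2
    have hsq : (θ * L) ^ 2 ≤ (θ * M) ^ 2 := sq_le_sq' (abs_le.1 hθL).1 (abs_le.1 hθL).2
    have hexp : Real.exp (θ * L) ≤ 1 + θ * L + (θ * M) ^ 2 := by linarith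
    calc (1 + a * c) * Real.exp (θ * L) ≤ (1 + a * c) * (1 + θ * L + (θ * M) ^ 2) := by gcongr
      _ = _ := by ring
  have hs := sum_mul_log_circleCos_le ha hε hε1 (by omega : 0 < q) x
  refine (Finset.sum_le_sum hterm).trans ?_
  rw [Finset.sum_add_distrib, ← Finset.mul_sum, ← Finset.mul_sum, Finset.sum_add_distrib,
    ← Finset.mul_sum, sum_circleCos_circleRat hq]
  simp only [Finset.sum_const, Finset.card_range, nsmul_eq_mul, mul_one, mul_zero, add_zero]
  have h1 : θ * (q * (1 - Real.log 2 + ε) + 4 * Real.pi)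
      = q * (θ * (1 - Real.log 2 + 4 * Real.pi / q + ε)) := by
    field_simp
    ring
  have h2 := mul_le_mul_of_nonneg_left hs hθ.le
  linarith

/-! ### Almost sure growth and the dimension bound -/

/-- Almost everywhere the logarithmic sums grow at most linearly, with any rate exceeding
`1 - log 2 + 4 π / q`. -/
theorem exists_ae_eventually_rieszLogSum_le {a : ℝ} (ha : a ∈ Set.Icc (-1 : ℝ) 1) {q : ℕ}
    (hq : 3 ≤ q) {lam : ℝ} (hlam : 1 - Real.log 2 + 4 * Real.pi / q < lam) :
    ∃ ε > 0, ∀ᵐ x ∂(rieszProduct a q : Measure UnitAddCircle),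
      ∀ᶠ n : ℕ in atTop, rieszLogSum a ε q n x ≤ n * lam := by
  set K := 1 - Real.log 2 + 4 * Real.pi / q with hK
  have hK0 : 0 ≤ K := by
    have h1 : 0 ≤ 4 * Real.pi / q := by positivity
    have h2 : Real.log 2 ≤ 1 := by linarith [Real.log_two_lt_d9]
    linarith
  set δ := lam - K with hδ
  have hδ0 : 0 < δ := by linarith
  set ε := min (1 / 2) (δ / 3) with hε
  have hε0 : 0 < ε := lt_min (by norm_num) (by linarith)
  have hε1 : ε ≤ 1 / 2 := min_le_left _ _
  have hε2 : ε ≤ δ / 3 := min_le_right _ _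
  set M := 1 - Real.log ε with hM
  have hM1 : 1 ≤ M := by linarith [Real.log_nonpos hε0.le (by linarith)]
  -- The first entry permits the quadratic bound on `exp`, the second makes its error at most `θ δ /
  -- 3`; with `ε ≤ δ / 3` a margin `θ δ / 3` is left.
  set θ := min (1 / M) (δ / 3 / M ^ 2) with hθ
  have hM0 : 0 < M := by linarith
  have hθ0 : 0 < θ := lt_min (by positivity) (by positivity)
  have hθ1 : θ * M ≤ 1 := (le_div_iff₀ hM0).1 (min_le_left _ _)
  have hθ2 : θ * M ^ 2 ≤ δ / 3 := (le_div_iff₀ (by positivity)).1 (min_le_right _ _)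
  set Λ := 1 + θ * (K + ε) + (θ * M) ^ 2 with hΛ
  have hΛ0 : 0 ≤ Λ := by positivity
  have hr : Λ * Real.exp (-(θ * lam)) < 1 := by
    have h1 : Λ ≤ Real.exp (θ * (K + ε) + (θ * M) ^ 2) := by
      have := Real.add_one_le_exp (θ * (K + ε) + (θ * M) ^ 2)
      linarith
    calc Λ * Real.exp (-(θ * lam))
        ≤ Real.exp (θ * (K + ε) + (θ * M) ^ 2) * Real.exp (-(θ * lam)) := by gcongr
      _ = Real.exp (θ * (K + ε + θ * M ^ 2 - lam)) := by rw [← Real.exp_add]; ring_nf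
      _ < 1 := by
        rw [Real.exp_lt_one_iff]
        exact mul_neg_of_pos_of_neg hθ0 (by linarith)
  refine ⟨ε, hε0, ?_⟩
  have hsum : ∑' n : ℕ, (rieszProduct a q : Measure UnitAddCircle)
      {x | n * lam < rieszLogSum a ε q n x} ≠ ⊤ := by
    refine ne_top_of_le_ne_top ?_ (ENNReal.tsum_le_tsum fun n =>
      rieszProduct_superlevel_le (lam := lam) ha hε0 hq hθ0 hΛ0
        (sum_mul_exp_log_le ha hε0 hε1 (by omega) hθ0 le_rfl hM1 hθ1) n)
    rw [ENNReal.tsum_geometric]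
    refine ENNReal.inv_ne_top.2 (tsub_pos_iff_lt.2 ?_).ne'
    rw [← ENNReal.ofReal_one]
    exact (ENNReal.ofReal_lt_ofReal_iff one_pos).2 hr
  filter_upwards [ae_eventually_notMem hsum] with x hx
  filter_upwards [hx] with n hn
  exact not_lt.1 hn

theorem proposition1p4 (q : ℕ) (hq : 3 ≤ q) (a : ℝ) (ha : a ∈ Set.Icc (-1 : ℝ) 1) :
    Tendsto (rieszPartial a q) atTop (𝓝 (rieszProduct a q)) ∧
      ENNReal.ofReal
          (1 - (1 - Real.log 2) / Real.log q - 4 * Real.pi / (q * Real.log q)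
            - 1 / Real.log q * (1 / Real.cos (Real.pi / q) - 1))
        ≤ lowerHausdorffDim (rieszProduct a q : Measure UnitAddCircle) := by
  refine ⟨tendsto_rieszPartial ha hq, le_sInf ?_⟩
  rintro α ⟨F, hF, hμF, hdim⟩
  by_contra! hlt
  obtain ⟨t, hαt, htD⟩ := ENNReal.lt_iff_exists_nnreal_btwn.1 hlt
  have ht0 : 0 < t := by
    have := zero_le.trans_lt hαt
    exact_mod_cast this
  have hq0 : (0 : ℝ) < q := by exact_mod_cast (by omega : 0 < q)
  have hq1 : (1 : ℝ) < q := by exact_mod_cast (by omega : 1 < q)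
  have hq3 : (3 : ℝ) ≤ q := by exact_mod_cast hq
  have hlog : 0 < Real.log q := Real.log_pos hq1
  have hcos : 0 < Real.cos (Real.pi / q) := by
    refine Real.cos_pos_of_mem_Ioo ⟨?_, ?_⟩
    · have : 0 < Real.pi / q := by positivity
      linarith [Real.pi_pos]
    · exact div_lt_div_of_pos_left Real.pi_pos two_pos (by linarith)
  have hcos1 : 0 ≤ 1 / Real.log q * (1 / Real.cos (Real.pi / q) - 1) := by
    have : 1 ≤ 1 / Real.cos (Real.pi / q) := (one_le_div hcos).2 (Real.cos_le_one _)
    exact mul_nonneg (by positivity) (by linarith)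
  have htD' : (t : ℝ) < 1 - (1 - Real.log 2) / Real.log q - 4 * Real.pi / (q * Real.log q) := by
    have h1 := Real.lt_toNNReal_iff_coe_lt.1 (ENNReal.coe_lt_coe.1 htD)
    linarith
  -- The rate `(1 - t) log q` is chosen so that `exp (n λ) / qⁿ = q ^ (-t n)`.
  have hlam : 1 - Real.log 2 + 4 * Real.pi / q < (1 - t) * Real.log q := by
    have h1 : (1 - Real.log 2 + 4 * Real.pi / q) / Real.log q
        = (1 - Real.log 2) / Real.log q + 4 * Real.pi / (q * Real.log q) := by
      field_simp
    rw [← div_lt_iff₀ hlog, h1]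
    linarith
  obtain ⟨ε, hε, hae⟩ := exists_ae_eventually_rieszLogSum_le ha hq hlam
  set μ := (rieszProduct a q : Measure UnitAddCircle) with hμ
  -- Fixing the starting index makes the growth bound uniform; countably many such sets cover almost
  -- every point, so one meets `F` in positive measure.
  set E : ℕ → Set UnitAddCircle := fun n₀ =>
    {x | ∀ n ≥ n₀, rieszLogSum a ε q n x ≤ n * ((1 - t) * Real.log q)} with hE
  have hEm : ∀ n₀, MeasurableSet (E n₀) := fun n₀ => by
    have : E n₀ = ⋂ n ≥ n₀, {x | rieszLogSum a ε q n x ≤ n * ((1 - t) * Real.log q)} := by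
      ext x
      simp [hE]
    rw [this]
    exact (isClosed_biInter fun n _ => isClosed_le (continuous_rieszLogSum ha hε q n)
      continuous_const).measurableSet
  obtain ⟨n₀, hn₀⟩ : ∃ n₀, μ (F ∩ E n₀) ≠ 0 := by
    by_contra! h
    refine hμF (measure_mono_null ?_ (measure_union_null (measure_iUnion_null h) (ae_iff.1 hae)))
    intro x hx
    by_cases hev : ∀ᶠ n : ℕ in atTop, rieszLogSum a ε q n x ≤ n * ((1 - t) * Real.log q)
    · obtain ⟨n₀, h0⟩ := eventually_atTop.1 hev
      exact Or.inl (Set.mem_iUnion.2 ⟨n₀, hx, h0⟩)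
    · exact Or.inr hev
  have hfin := le_dimH_of_measure_ball_le (hF.inter (hEm n₀)) hn₀ hq1
    (Real.exp_pos (Real.pi / ε)) ht0 n₀ fun x hx n hn => by
      refine (rieszProduct_ball_le ha hε hq n x).trans (ENNReal.ofReal_le_ofReal ?_)
      have h1 : rieszLogSum a ε q n x ≤ n * ((1 - t) * Real.log q) := hx.2 n hn
      have h2 : Real.exp (n * ((1 - t) * Real.log q)) = ((q : ℝ) ^ (-(t : ℝ))) ^ n * (q : ℝ) ^ n := by
        rw [← mul_pow, Real.exp_nat_mul, Real.rpow_def_of_pos hq0]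
        nth_rewrite 3 [← Real.exp_log hq0]
        rw [← Real.exp_add]
        congr 2
        ring
      rw [Real.exp_add, div_le_iff₀ (by positivity), mul_assoc, ← h2]
      gcongr
  exact absurd ((hfin.trans (dimH_mono Set.inter_subset_left)).trans hdim) (not_le.2 hαt)
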